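/- All inner products are linear in the first argument, and $\langle f,g\rangle=\int_{\mathbb R} f\overline g\,dx$. For $\phi,\psi\in L^2(\mathbb R)$ let $A$ be the operator in $L^2(\mathbb R)$ with $$(Af)(x)=xf(x)+\langle f,\phi\rangle\psi(x),\qquad D(A)=\Big\{f\in L^2(\mathbb R): xf\in L^2(\mathbb R),\ \lim_{R\to\infty}\int_{-R}^R f\,dx \text{ exists and equals } 0\Big\},$$ and let $\widetilde A$ be the operator on the same domain in which the roles of $\phi$ and $\psi$ are swapped, $(\widetilde Af)(x)=xf(x)+\langle f,\psi\rangle\phi(x)$. For $u\in D(\widetilde A^*)$ put $\Gamma_1u=\lim_{R\to\infty}\int_{-R}^Ru\,dx$ and $\Gamma_2u=c_u$, the unique constant $c$ with $xu(x)-c\in L^2(\mathbb R)$. For $B\in\mathbb C$ let $A_B$ be the restriction of $\widetilde A^*$ to $\ker(\Gamma_1-B\Gamma_2)$. For $\lambda$ in the resolvent set $\rho(A_B)$ the $M$-function $M_B(\lambda)\in\mathbb C$ is determined by $$M_B(\lambda)(\Gamma_1-B\Gamma_2)u=\Gamma_2u\quad\text{for all } u\in\ker(\widetilde A^*-\lambda),$$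 where $(\Gamma_1-B\Gamma_2)u$ runs through all of $\mathbb C$. Let $\overline{\mathcal S}$ be the closed linear span of the spaces $\ker(\widetilde A^*-\lambda)$, $\lambda\in\bigcup_{C\in\mathbb C}\rho(A_C)$ (the detectable subspace). **Theorem.** The family of restricted resolvents $(A_B-\lambda)^{-1}|_{\overline{\mathcal S}}$, $\lambda\in\rho(A_B)\setminus\mathbb R$, determines the function $M_B$. That is, there is a single map, independent of $\phi,\psi,B$, which for all $\phi,\psi\in L^2(\mathbb R)$ and $B\in\mathbb C$ takes the family $\big((A_B-\lambda)^{-1}|_{\overline{\mathcal S}}\big)_{\lambda\in\rho(A_B)\setminus\mathbb R}$ (including its index set and the space $\overline{\mathcal S}$ on which these operators are given, but no other information on $\phi$, $\psi$ or $B$) to a function whose value at every $\lambda\in\rho(A_B)$ is $M_B(\lambda)$. -/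

import Mathlib

open MeasureTheory Filter Topology

noncomputable section

namespace Friedrichs

/-- The Hilbert space `L²(ℝ)` of complex-valued functions. -/
abbrev L2 : Type := Lp ℂ 2 (volume : Measure ℝ)

theorem L2.intervalIntegrable (f : L2) (a b : ℝ) : IntervalIntegrable f volume a b := by
  have h : LocallyIntegrable f (volume : Measure ℝ) :=
    (Lp.memLp f).locallyIntegrable (by norm_num)
  exact (h.integrableOn_isCompact isCompact_uIcc).intervalIntegrable

theorem integral_add_L2 (f g : L2) (a b : ℝ) :
    (∫ x in a..b, (f + g : L2) x) = (∫ x in a..b, f x) + ∫ x in a..b, g x := by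
  rw [← intervalIntegral.integral_add (L2.intervalIntegrable f a b) (L2.intervalIntegrable g a b)]
  refine intervalIntegral.integral_congr_ae ?_
  filter_upwards [Lp.coeFn_add f g] with x hx _
  simpa using hx

theorem integral_smul_L2 (c : ℂ) (f : L2) (a b : ℝ) :
    (∫ x in a..b, (c • f : L2) x) = c * ∫ x in a..b, f x := by
  rw [← intervalIntegral.integral_const_mul]
  refine intervalIntegral.integral_congr_ae ?_
  filter_upwards [Lp.coeFn_smul c f] with x hx _
  simpa using hx

/-- `u` has boundary values `Γ₁ u = a` and `Γ₂ u = c`: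
`a = lim_{R → ∞} ∫_{-R}^R u(x) dx`, and `c` is the constant for which `x u(x) - c` lies in `L²(ℝ)`.
Both numbers are determined by `u`, because limits are unique and non-zero constants are not
square integrable. -/
def HasTraces (u : L2) (a c : ℂ) : Prop :=
  Tendsto (fun R : ℝ => ∫ x in (-R)..R, u x) atTop (𝓝 a) ∧
    MemLp (fun x : ℝ => (x : ℂ) * u x - c) 2 volume

theorem HasTraces.zero : HasTraces 0 0 0 := by
  refine ⟨?_, ?_⟩
  · have h : ∀ R : ℝ, (∫ x in (-R)..R, (0 : L2) x) = 0 := fun R => by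
      have h := integral_smul_L2 0 0 (-R) R
      rwa [zero_smul, zero_mul] at h
    simp only [h]
    exact tendsto_const_nhds
  · refine (MemLp.zero (p := 2) (μ := (volume : Measure ℝ)) (ε := ℂ)).ae_eq ?_
    filter_upwards [Lp.coeFn_zero ℂ 2 (volume : Measure ℝ)] with x hx
    simp

theorem HasTraces.add {u v : L2} {a b c d : ℂ} (hu : HasTraces u a c) (hv : HasTraces v b d) :
    HasTraces (u + v) (a + b) (c + d) := by
  refine ⟨?_, ?_⟩
  · simp only [integral_add_L2]
    exact hu.1.add hv.1
  · refine (hu.2.add hv.2).ae_eq ?_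
    filter_upwards [Lp.coeFn_add u v] with x hx
    simp only [hx, Pi.add_apply]
    ring

theorem HasTraces.smul (k : ℂ) {u : L2} {a c : ℂ} (hu : HasTraces u a c) :
    HasTraces (k • u) (k * a) (k * c) := by
  refine ⟨?_, ?_⟩
  · simp only [integral_smul_L2]
    exact hu.1.const_mul k
  · refine (hu.2.const_mul k).ae_eq ?_
    filter_upwards [Lp.coeFn_smul k u] with x hx
    simp only [hx, Pi.smul_apply, smul_eq_mul]
    ring

/-- The domain of the minimal operator: all `f ∈ L²(ℝ)` with `x f(x) ∈ L²(ℝ)` for which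
`lim_{R → ∞} ∫_{-R}^R f(x) dx` exists and is zero. -/
def minDomain : Submodule ℂ L2 where
  carrier := {f | MemLp (fun x : ℝ => (x : ℂ) * f x) 2 volume ∧
    Tendsto (fun R : ℝ => ∫ x in (-R)..R, f x) atTop (𝓝 0)}
  zero_mem' := ⟨by simpa using HasTraces.zero.2, HasTraces.zero.1⟩
  add_mem' := by
    intro f g hf hg
    have h := HasTraces.add (u := f) (v := g) (a := 0) (b := 0) (c := 0) (d := 0)
      ⟨hf.2, by simpa using hf.1⟩ ⟨hg.2, by simpa using hg.1⟩
    exact ⟨by simpa using h.2, by simpa using h.1⟩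
  smul_mem' := by
    intro k f hf
    have h := HasTraces.smul k (u := f) (a := 0) (c := 0) ⟨hf.2, by simpa using hf.1⟩
    exact ⟨by simpa using h.2, by simpa using h.1⟩

/-- Multiplication by the independent variable, on `minDomain`. -/
def mulX : minDomain →ₗ[ℂ] L2 where
  toFun f := f.2.1.toLp _
  map_add' := by
    intro f g
    rw [← MemLp.toLp_add]
    refine MemLp.toLp_congr _ _ ?_
    filter_upwards [Lp.coeFn_add (f : L2) (g : L2)] with x hx
    simp only [Submodule.coe_add, hx, Pi.add_apply]
    ring
  map_smul' := by
    intro k f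
    rw [RingHom.id_apply, ← MemLp.toLp_const_smul]
    refine MemLp.toLp_congr _ _ ?_
    filter_upwards [Lp.coeFn_smul k (f : L2)] with x hx
    simp only [Submodule.coe_smul, hx, Pi.smul_apply, smul_eq_mul]
    ring

/-- The minimal Friedrichs operator `(A f)(x) = x f(x) + ⟨f, φ⟩ ψ(x)`, where
`⟨f, φ⟩ = ∫ f(x) conj(φ(x)) dx` is linear in `f` (Mathlib's `inner` is linear in its second
argument). -/
def minOp (φ ψ : L2) : L2 →ₗ.[ℂ] L2 where
  domain := minDomain
  toFun := mulX + ((innerSL ℂ φ : L2 →L[ℂ] ℂ).toLinearMap.smulRight ψ).comp minDomain.subtype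

/-- The operator `Ã`, in which the roles of `φ` and `ψ` are swapped. -/
def tildeOp (φ ψ : L2) : L2 →ₗ.[ℂ] L2 := minOp ψ φ

/-- The maximal operator `Ã*`, the Hilbert space adjoint of `Ã`. -/
def maxOp (φ ψ : L2) : L2 →ₗ.[ℂ] L2 := (tildeOp φ ψ).adjoint

/-- The boundary condition `(Γ₁ - B Γ₂) u = 0`. -/
def boundaryCondition (B : ℂ) : Submodule ℂ L2 where
  carrier := {u | ∃ a c : ℂ, HasTraces u a c ∧ a - B * c = 0}
  zero_mem' := ⟨0, 0, HasTraces.zero, by simp⟩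
  add_mem' := by
    rintro u v ⟨a, c, hu, h⟩ ⟨b, d, hv, h'⟩
    exact ⟨a + b, c + d, hu.add hv, by linear_combination h + h'⟩
  smul_mem' := by
    rintro k u ⟨a, c, hu, h⟩
    exact ⟨k * a, k * c, hu.smul k, by linear_combination k * h⟩

/-- The operator `A_B`, the restriction of `Ã*` to `ker (Γ₁ - B Γ₂)`. -/
def bdryOp (φ ψ : L2) (B : ℂ) : L2 →ₗ.[ℂ] L2 := (maxOp φ ψ).domRestrict (boundaryCondition B)

/-- `R` is the bounded resolvent `(T - z)⁻¹`: a bounded everywhere defined two-sided inverse of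
`T - z : D(T) → L²(ℝ)`. -/
def IsResolventAt (T : L2 →ₗ.[ℂ] L2) (z : ℂ) (R : L2 →L[ℂ] L2) : Prop :=
  (∀ g : L2, ∃ f : T.domain, (f : L2) = R g ∧ T f - z • (f : L2) = g) ∧
    ∀ f : T.domain, R (T f - z • (f : L2)) = f

/-- The resolvent set `ρ(T)` of an unbounded operator. -/
def resolventSet (T : L2 →ₗ.[ℂ] L2) : Set ℂ := {z | ∃ R : L2 →L[ℂ] L2, IsResolventAt T z R}

/-- The kernel `ker (Ã* - z)`. -/
def defectSpace (φ ψ : L2) (z : ℂ) : Set L2 :=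
  {u | ∃ h : u ∈ (maxOp φ ψ).domain, maxOp φ ψ ⟨u, h⟩ = z • u}

/-- The detectable subspace: the closed linear span of all `ker (Ã* - z)` with `z` in the union of
the resolvent sets `ρ(A_C)` over all boundary parameters `C`. -/
def detectable (φ ψ : L2) : Submodule ℂ L2 :=
  (Submodule.span ℂ
    {u : L2 | ∃ z C : ℂ, z ∈ resolventSet (bdryOp φ ψ C) ∧ u ∈ defectSpace φ ψ z}).topologicalClosure

/-- The family of restricted resolvents `(A_B - z)⁻¹`, restricted to the detectable subspace, over
all non-real `z ∈ ρ(A_B)`, encoded by its graph: the set of all `(z, g, f)` with `z` non-real in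
`ρ(A_B)`, `g` in the detectable subspace and `f = (A_B - z)⁻¹ g`. -/
def restrictedResolvents (φ ψ : L2) (B : ℂ) : Set (ℂ × L2 × L2) :=
  {p | p.1.im ≠ 0 ∧ p.2.1 ∈ detectable φ ψ ∧
    ∃ R : L2 →L[ℂ] L2, IsResolventAt (bdryOp φ ψ B) p.1 R ∧ R p.2.1 = p.2.2}

/-- `m` is the value `M_B(z)` of the `M`-function, i.e. multiplication by `m` is the map defined
on all of `ℂ` by `(Γ₁ - B Γ₂) u ↦ Γ₂ u` for `u ∈ ker (Ã* - z)`. There is at most one such `m`. -/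
def IsMValue (φ ψ : L2) (B z m : ℂ) : Prop :=
  ∀ h k : ℂ, k = m * h ↔
    ∃ u ∈ defectSpace φ ψ z, ∃ a c : ℂ, HasTraces u a c ∧ a - B * c = h ∧ c = k

end Friedrichs

end

noncomputable section

namespace Friedrichs

open scoped ComplexConjugate

/-! A recovering map exists by choice once two models `(φ, ψ, B)` and `(φ', ψ', B')` with the same
restricted resolvents are shown to have the same `M`-values. Such models have the same resolvent
set, since no real point belongs to one (`im_ne_zero_of_mem_resolventSet`). Let `u` lie in `ker (Ã*
- z)`, normalised by `(Γ₁ - B Γ₂) u = 1`, so that `M_B(z) = Γ₂ u`. As `u` is detectable, both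
resolvents at `w` send it to the same `f`. Hence `f` satisfies both boundary conditions, both
rank-one perturbations agree on `f`, and `u + (w - z) f` lies in `ker (Ã* - w)` with the same
normalisation (`exists_defect_continuation`). Now let `w = ± i t` with `t → ∞`. There the
perturbation is negligible, and defect elements behave like multiples of `1 / (x - w)`, with `Γ₁ ≈ ±
π i Γ₂` (`eventually_defect_estimate`). If `B ≠ B'`, then `f` has zero traces, so the continuation
keeps the traces of `u`; the two half-axes then force both traces to vanish, contradicting the
normalisation. So `B = B'` (`boundaryParameter_eq`). Moreover the continuations tend to `0` along a
suitable half-axis, while the difference of the two perturbations takes the same value on them as on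
`u`; that value is therefore `0` (`perturbation_eq_on_defectSpace`). Thus `u` is a defect element of
both models with the same traces, and the `M`-values coincide. -/

theorem HasTraces.mem_minDomain {u : L2} (h : HasTraces u 0 0) : u ∈ minDomain :=
  ⟨by simpa using h.2, h.1⟩

/-! ### Compactly supported test functions and the adjoint of multiplication by `x` -/

theorem memLp_const_eq_zero {c : ℂ} (h : MemLp (fun _ : ℝ => c) 2 volume) : c = 0 := by
  rw [memLp_const_iff (by norm_num) (by norm_num)] at h
  simpa using h

/-- The indicator function of a compact set as an element of `L²(ℝ)`. -/
def compactIndicator {s : Set ℝ} (hs : IsCompact s) : L2 :=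
  indicatorConstLp 2 hs.measurableSet hs.measure_lt_top.ne (1 : ℂ)

theorem compactIndicator_ae {s : Set ℝ} (hs : IsCompact s) :
    compactIndicator hs =ᵐ[volume] s.indicator fun _ => (1 : ℂ) :=
  indicatorConstLp_coeFn

theorem inner_compactIndicator {s : Set ℝ} (hs : IsCompact s) (f : L2) :
    inner ℂ (compactIndicator hs) f = ∫ x in s, f x :=
  L2.inner_indicatorConstLp_one hs.measurableSet hs.measure_lt_top.ne f

theorem memLp_mul_compactIndicator {s : Set ℝ} (hs : IsCompact s) :
    MemLp (fun x : ℝ => (x : ℂ) * compactIndicator hs x) 2 volume := by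
  have h : MemLp (s.indicator fun x : ℝ => (x : ℂ)) 2 volume := by
    rw [memLp_indicator_iff_restrict hs.measurableSet]
    obtain ⟨C, hC⟩ := hs.exists_bound_of_continuousOn (f := fun x : ℝ => (x : ℂ)) (by fun_prop)
    have : IsFiniteMeasure ((volume : Measure ℝ).restrict s) :=
      ⟨by simpa using hs.measure_lt_top⟩
    refine MemLp.of_bound (by fun_prop) C ?_
    exact (ae_restrict_iff' hs.measurableSet).2 (.of_forall hC)
  refine h.ae_eq ?_
  filter_upwards [compactIndicator_ae hs] with x hx
  rw [hx]
  by_cases h : x ∈ s <;> simp [h]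

theorem hasTraces_compactIndicator {s : Set ℝ} (hs : IsCompact s) :
    HasTraces (compactIndicator hs) (volume.real s : ℂ) 0 := by
  refine ⟨?_, by simpa using memLp_mul_compactIndicator hs⟩
  have hi : Integrable (compactIndicator hs) volume :=
    integrable_indicatorConstLp hs.measurableSet hs.measure_lt_top.ne 1
  have h := intervalIntegral_tendsto_integral hi tendsto_neg_atTop_atBot tendsto_id
  have h2 : ∫ x, compactIndicator hs x = (volume.real s : ℂ) := by
    rw [integral_congr_ae (compactIndicator_ae hs), integral_indicator hs.measurableSet]
    simp
  rwa [h2] at h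

theorem inner_mul_compactIndicator {s : Set ℝ} (hs : IsCompact s) (u : L2) :
    inner ℂ ((memLp_mul_compactIndicator hs).toLp _) u = ∫ x in s, (x : ℂ) * u x := by
  rw [L2.inner_def, ← integral_indicator hs.measurableSet]
  refine integral_congr_ae ?_
  filter_upwards [(memLp_mul_compactIndicator hs).coeFn_toLp, compactIndicator_ae hs] with x h1 h2
  rw [h1, h2]
  by_cases h : x ∈ s <;> simp [h, mul_comm]

theorem mulX_ae (f : minDomain) : mulX f =ᵐ[volume] fun x : ℝ => (x : ℂ) * (f : L2) x :=
  f.2.1.coeFn_toLp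

theorem locallyIntegrable_mul (u : L2) :
    LocallyIntegrable (fun x : ℝ => (x : ℂ) * u x) volume := by
  have h : LocallyIntegrable u (volume : Measure ℝ) := (Lp.memLp u).locallyIntegrable (by norm_num)
  have h2 := (locallyIntegrableOn_univ.2 h).continuousOn_mul
    (g := fun x : ℝ => (x : ℂ)) (by fun_prop) isOpen_univ.isLocallyClosed
  exact locallyIntegrableOn_univ.1 h2

theorem compactIndicator_sub_mem_minDomain {s t : Set ℝ} (hs : IsCompact s) (ht : IsCompact t)
    (h1 : volume.real t = 1) :
    compactIndicator hs + (-(volume.real s : ℂ)) • compactIndicator ht ∈ minDomain := by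
  have h := (hasTraces_compactIndicator hs).add
    ((hasTraces_compactIndicator ht).smul (-(volume.real s : ℂ)))
  rw [h1] at h
  exact HasTraces.mem_minDomain (by simpa using h)

/-- The adjoint relation of multiplication by `x` on `minDomain`. -/
theorem inner_mulX_iff (u v : L2) :
    (∀ f : minDomain, inner ℂ v (f : L2) = inner ℂ u (mulX f)) ↔
      ∃ c : ℂ, ∀ᵐ x : ℝ, v x = (x : ℂ) * u x - c := by
  constructor
  · intro H
    have hI : IsCompact (Set.Icc (0 : ℝ) 1) := isCompact_Icc
    set w : ℝ → ℂ := fun x => v x - (x : ℂ) * u x with hw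
    have hv : LocallyIntegrable v (volume : Measure ℝ) :=
      (Lp.memLp v).locallyIntegrable (by norm_num)
    have hwl : LocallyIntegrable w volume := hv.sub (locallyIntegrable_mul u)
    -- Test with `1_s - |s| 1_[0,1]`, whose integral is zero; hence `w` minus its mean over `[0,1]`
    -- integrates to zero over every compact set.
    have hint : ∀ s : Set ℝ, IsCompact s →
        ∫ x in s, w x = (volume.real s : ℂ) * ∫ x in Set.Icc (0 : ℝ) 1, w x := by
      intro s hs
      have e := H ⟨_, compactIndicator_sub_mem_minDomain hs hI (by simp)⟩
      have hm : mulX ⟨_, compactIndicator_sub_mem_minDomain hs hI (by simp)⟩ =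
          (memLp_mul_compactIndicator hs).toLp _ +
            (-(volume.real s : ℂ)) • (memLp_mul_compactIndicator hI).toLp _ := by
        refine Lp.ext ?_
        filter_upwards [mulX_ae ⟨_, compactIndicator_sub_mem_minDomain hs hI (by simp)⟩,
          Lp.coeFn_add ((memLp_mul_compactIndicator hs).toLp _)
            ((-(volume.real s : ℂ)) • (memLp_mul_compactIndicator hI).toLp _),
          Lp.coeFn_smul (-(volume.real s : ℂ)) ((memLp_mul_compactIndicator hI).toLp _),
          (memLp_mul_compactIndicator hs).coeFn_toLp, (memLp_mul_compactIndicator hI).coeFn_toLp,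
          Lp.coeFn_add (compactIndicator hs) ((-(volume.real s : ℂ)) • compactIndicator hI),
          Lp.coeFn_smul (-(volume.real s : ℂ)) (compactIndicator hI)] with x h1 h2 h3 h4 h5 h6 h7
        rw [h1, h2, Pi.add_apply, h3, Pi.smul_apply, h4, h5, h6, Pi.add_apply, h7, Pi.smul_apply]
        simp only [smul_eq_mul]
        ring
      rw [hm] at e
      have e' := congrArg conj e
      rw [inner_conj_symm, inner_conj_symm, inner_add_left, inner_add_left, inner_smul_left,
        inner_smul_left, inner_compactIndicator, inner_compactIndicator,
        inner_mul_compactIndicator, inner_mul_compactIndicator] at e'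
      have i1 : ∀ t : Set ℝ, IsCompact t →
          ∫ x in t, w x = (∫ x in t, v x) - ∫ x in t, (x : ℂ) * u x := fun t ht =>
        integral_sub (hv.integrableOn_isCompact ht)
          ((locallyIntegrable_mul u).integrableOn_isCompact ht)
      rw [i1 s hs, i1 _ hI]
      simp only [map_neg, Complex.conj_ofReal] at e'
      linear_combination e'
    set C := ∫ x in Set.Icc (0 : ℝ) 1, w x
    have hz : ∀ᵐ x : ℝ, w x - C = 0 := by
      refine ae_eq_zero_of_forall_setIntegral_isCompact_eq_zero'
        (hwl.sub (locallyIntegrable_const C)) fun s hs => ?_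
      change ∫ x in s, (w x - C) = 0
      rw [integral_sub (hwl.integrableOn_isCompact hs)
        ((locallyIntegrable_const C).integrableOn_isCompact hs), hint s hs]
      simp
    refine ⟨-C, ?_⟩
    filter_upwards [hz] with x hx
    linear_combination hx
  · rintro ⟨c, hc⟩ f
    have hi1 := L2.integrable_inner (𝕜 := ℂ) v (f : L2)
    have hi2 := L2.integrable_inner (𝕜 := ℂ) u (mulX f)
    have hd : (fun x => inner ℂ (u x) (mulX f x) - inner ℂ (v x) ((f : L2) x)) =ᵐ[volume]
        fun x => conj c * (f : L2) x := by
      filter_upwards [hc, mulX_ae f] with x h1 h2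
      rw [h1, h2]
      simp
      ring
    -- `f` itself need not be known to be integrable: `conj c * f` is a difference of products of
    -- `L²` functions, so its integral is the symmetric limit, which is zero on `minDomain`.
    have hg : Integrable (fun x => conj c * (f : L2) x) volume := (hi2.sub hi1).congr hd
    have h1 := intervalIntegral_tendsto_integral hg tendsto_neg_atTop_atBot tendsto_id
    simp only [intervalIntegral.integral_const_mul, id] at h1
    have h2 := tendsto_nhds_unique h1 (f.2.2.const_mul (conj c))
    rw [← integral_congr_ae hd, integral_sub hi2 hi1, mul_zero] at h2
    rw [L2.inner_def, L2.inner_def]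
    exact (sub_eq_zero.1 h2).symm

/-- A vector orthogonal to the domain satisfies the adjoint relation with `u = 0`, so it is a square
integrable constant. -/
theorem dense_minDomain : Dense (minDomain : Set L2) := by
  rw [Submodule.dense_iff_topologicalClosure_eq_top, Submodule.topologicalClosure_eq_top_iff,
    Submodule.eq_bot_iff]
  intro v hv
  obtain ⟨c, hc⟩ := (inner_mulX_iff 0 v).1 fun f => by
    rw [inner_zero_left]
    exact (Submodule.mem_orthogonal' _ _).1 hv f f.2
  have hc' : ∀ᵐ x : ℝ, v x = -c := by
    filter_upwards [hc, Lp.coeFn_zero ℂ 2 (volume : Measure ℝ)] with x h1 h2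
    simp [h1]
  have h0 := memLp_const_eq_zero ((Lp.memLp v).ae_eq hc')
  refine Lp.ext ?_
  filter_upwards [hc', Lp.coeFn_zero ℂ 2 (volume : Measure ℝ)] with x h1 h2
  rw [h1, h0, h2]
  rfl

/-! ### Explicit graphs of the maximal operator and of `A_B` -/

/-- The explicit form of the graph of the maximal operator: `v = Ã* u` with `Γ₂ u = c`. -/
def MaxRel (φ ψ u v : L2) (c : ℂ) : Prop :=
  ∀ᵐ x : ℝ, v x = (x : ℂ) * u x - c + inner ℂ φ u * ψ x

theorem MaxRel.memLp {φ ψ u v : L2} {c : ℂ} (h : MaxRel φ ψ u v c) :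
    MemLp (fun x : ℝ => (x : ℂ) * u x - c) 2 volume := by
  refine (Lp.memLp (v - inner ℂ φ u • ψ)).ae_eq ?_
  filter_upwards [h, Lp.coeFn_sub v (inner ℂ φ u • ψ), Lp.coeFn_smul (inner ℂ φ u) ψ] with x h1 h2 h3
  rw [h2, Pi.sub_apply, h3, h1, Pi.smul_apply, smul_eq_mul]
  ring

theorem traceConst_unique {u : L2} {c d : ℂ}
    (hc : MemLp (fun x : ℝ => (x : ℂ) * u x - c) 2 volume)
    (hd : MemLp (fun x : ℝ => (x : ℂ) * u x - d) 2 volume) : c = d := by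
  have h : MemLp (fun _ : ℝ => d - c) 2 volume := by
    refine (hc.sub hd).ae_eq (.of_forall fun x => ?_)
    simp only [Pi.sub_apply]
    ring
  exact (sub_eq_zero.1 (memLp_const_eq_zero h)).symm

theorem HasTraces.unique {u : L2} {a b c d : ℂ} (h : HasTraces u a c) (h' : HasTraces u b d) :
    a = b ∧ c = d :=
  ⟨tendsto_nhds_unique h.1 h'.1, traceConst_unique h.2 h'.2⟩

theorem tildeOp_apply (φ ψ : L2) (f : (tildeOp φ ψ).domain) :
    tildeOp φ ψ f = mulX f + inner ℂ ψ (f : L2) • φ :=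
  rfl

theorem inner_tildeOp_iff (φ ψ u v : L2) (f : minDomain) :
    inner ℂ v (f : L2) = inner ℂ u (tildeOp φ ψ f) ↔
      inner ℂ (v - inner ℂ φ u • ψ) (f : L2) = inner ℂ u (mulX f) := by
  rw [tildeOp_apply φ ψ f, inner_sub_left, inner_add_right, inner_smul_left, inner_smul_right,
    inner_conj_symm, sub_eq_iff_eq_add, mul_comm (inner ℂ u φ)]

theorem maxRel_iff_sub {φ ψ u v : L2} {c : ℂ} :
    MaxRel φ ψ u v c ↔ ∀ᵐ x : ℝ, (v - inner ℂ φ u • ψ : L2) x = (x : ℂ) * u x - c := by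
  refine eventually_congr ?_
  filter_upwards [Lp.coeFn_sub v (inner ℂ φ u • ψ), Lp.coeFn_smul (inner ℂ φ u) ψ] with x h2 h3
  rw [h2, Pi.sub_apply, h3, Pi.smul_apply, smul_eq_mul, sub_eq_iff_eq_add]

/-- The adjoint of the bounded term `⟨·, ψ⟩ φ` is `⟨·, φ⟩ ψ`; moving it to the other side leaves the
adjoint relation of multiplication by `x`. -/
theorem mem_maxOp_graph_iff (φ ψ u v : L2) :
    (∃ h : u ∈ (maxOp φ ψ).domain, maxOp φ ψ ⟨u, h⟩ = v) ↔ ∃ c, MaxRel φ ψ u v c := by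
  have hd : Dense ((tildeOp φ ψ).domain : Set L2) := dense_minDomain
  simp only [maxRel_iff_sub, ← inner_mulX_iff, ← inner_tildeOp_iff]
  constructor
  · rintro ⟨h, rfl⟩ f
    exact LinearPMap.adjoint_isFormalAdjoint hd ⟨u, h⟩ f
  · intro H
    have h : u ∈ (maxOp φ ψ).domain := LinearPMap.mem_adjoint_domain_of_exists u ⟨v, H⟩
    exact ⟨h, LinearPMap.adjoint_apply_eq hd ⟨u, h⟩ H⟩

theorem mem_bdryOp_graph_iff (φ ψ : L2) (B : ℂ) (u v : L2) :
    (∃ h : u ∈ (bdryOp φ ψ B).domain, bdryOp φ ψ B ⟨u, h⟩ = v) ↔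
      ∃ a c, HasTraces u a c ∧ a = B * c ∧ MaxRel φ ψ u v c := by
  constructor
  · rintro ⟨h, hv⟩
    obtain ⟨⟨a, c, ht, hac⟩, h2⟩ := (Submodule.mem_inf.1 h :)
    have hv' : maxOp φ ψ ⟨u, h2⟩ = v := by
      rw [← hv]
      exact (LinearPMap.domRestrict_apply rfl).symm
    obtain ⟨d, hd⟩ := (mem_maxOp_graph_iff φ ψ u v).1 ⟨h2, hv'⟩
    obtain rfl := traceConst_unique ht.2 hd.memLp
    exact ⟨a, c, ht, sub_eq_zero.1 hac, hd⟩
  · rintro ⟨a, c, ht, hac, hr⟩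
    obtain ⟨h2, hv'⟩ := (mem_maxOp_graph_iff φ ψ u v).2 ⟨c, hr⟩
    refine ⟨Submodule.mem_inf.2 ⟨⟨a, c, ht, sub_eq_zero.2 hac⟩, h2⟩, ?_⟩
    rw [← hv']
    exact LinearPMap.domRestrict_apply rfl

theorem mem_defectSpace_iff (φ ψ : L2) (z : ℂ) (u : L2) :
    u ∈ defectSpace φ ψ z ↔ ∃ c, MaxRel φ ψ u (z • u) c :=
  mem_maxOp_graph_iff φ ψ u (z • u)

theorem MaxRel.add {φ ψ u u' v v' : L2} {c c' : ℂ} (h : MaxRel φ ψ u v c)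
    (h' : MaxRel φ ψ u' v' c') : MaxRel φ ψ (u + u') (v + v') (c + c') := by
  filter_upwards [h, h', Lp.coeFn_add u u', Lp.coeFn_add v v'] with x h1 h2 h3 h4
  rw [h3, h4, Pi.add_apply, Pi.add_apply, h1, h2, inner_add_right]
  ring

theorem MaxRel.smul {φ ψ u v : L2} {c : ℂ} (k : ℂ) (h : MaxRel φ ψ u v c) :
    MaxRel φ ψ (k • u) (k • v) (k * c) := by
  filter_upwards [h, Lp.coeFn_smul k u, Lp.coeFn_smul k v] with x h1 h3 h4
  rw [h3, h4, Pi.smul_apply, Pi.smul_apply, h1, inner_smul_right, smul_eq_mul, smul_eq_mul]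
  ring

/-- Resolvents of `A_B` in terms of the explicit graph. -/
theorem isResolventAt_bdryOp_iff (φ ψ : L2) (B z : ℂ) (R : L2 →L[ℂ] L2) :
    IsResolventAt (bdryOp φ ψ B) z R ↔
      (∀ g : L2, ∃ a c, HasTraces (R g) a c ∧ a = B * c ∧ MaxRel φ ψ (R g) (g + z • R g) c) ∧
        ∀ u g : L2, (∃ a c, HasTraces u a c ∧ a = B * c ∧ MaxRel φ ψ u (g + z • u) c) →
          R g = u := by
  simp only [← mem_bdryOp_graph_iff]
  constructor
  · rintro ⟨h1, h2⟩
    refine ⟨fun g => ?_, ?_⟩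
    · obtain ⟨f, hf, e⟩ := h1 g
      rw [← hf]
      exact ⟨f.2, by rw [← e]; abel_nf⟩
    · rintro u g ⟨h, e⟩
      have := h2 ⟨u, h⟩
      rw [e] at this
      simpa using this
  · rintro ⟨h1, h2⟩
    refine ⟨fun g => ?_, fun f => ?_⟩
    · obtain ⟨h, e⟩ := h1 g
      exact ⟨⟨R g, h⟩, rfl, by rw [e]; simp⟩
    · exact h2 f _ ⟨f.2, by simp⟩

/-! ### Cauchy kernels on the imaginary axis -/

/-- The point `σ t i` of the imaginary axis. -/
def imagPt (σ t : ℝ) : ℂ := ((σ * t : ℝ) : ℂ) * Complex.I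

theorem normSq_sub_imagPt {σ : ℝ} (hσ : σ ^ 2 = 1) (t x : ℝ) :
    Complex.normSq ((x : ℂ) - imagPt σ t) = x ^ 2 + t ^ 2 := by
  simp only [imagPt, Complex.normSq_apply, Complex.sub_re, Complex.sub_im, Complex.mul_re,
    Complex.mul_im, Complex.ofReal_re, Complex.ofReal_im, Complex.I_re, Complex.I_im]
  linear_combination t ^ 2 * hσ

theorem sub_imagPt_ne_zero {σ t : ℝ} (hσ : σ ^ 2 = 1) (ht : 0 < t) (x : ℝ) :
    (x : ℂ) - imagPt σ t ≠ 0 := by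
  intro h
  have := normSq_sub_imagPt hσ t x
  rw [h, map_zero] at this
  nlinarith [sq_nonneg x]

theorem norm_inv_sub_imagPt_sq {σ : ℝ} (hσ : σ ^ 2 = 1) (t x : ℝ) :
    ‖((x : ℂ) - imagPt σ t)⁻¹‖ ^ 2 = (x ^ 2 + t ^ 2)⁻¹ := by
  rw [norm_inv, inv_pow, ← Complex.normSq_eq_norm_sq, normSq_sub_imagPt hσ]

theorem norm_inv_sub_imagPt_le {σ t : ℝ} (hσ : σ ^ 2 = 1) (ht : 0 < t) (x : ℝ) :
    ‖((x : ℂ) - imagPt σ t)⁻¹‖ ≤ t⁻¹ := by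
  refine le_of_sq_le_sq ?_ (by positivity)
  rw [norm_inv_sub_imagPt_sq hσ, inv_pow]
  gcongr
  nlinarith [sq_nonneg x]

theorem continuous_inv_sub_imagPt {σ t : ℝ} (hσ : σ ^ 2 = 1) (ht : 0 < t) :
    Continuous fun x : ℝ => ((x : ℂ) - imagPt σ t)⁻¹ :=
  Continuous.inv₀ (by fun_prop) (sub_imagPt_ne_zero hσ ht)

theorem inv_sq_add_sq_eq {t : ℝ} (ht : 0 < t) (x : ℝ) :
    (x ^ 2 + t ^ 2)⁻¹ = (t ^ 2)⁻¹ * (1 + (x / t) ^ 2)⁻¹ := by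
  field_simp
  ring

theorem integrable_inv_sq_add_sq {t : ℝ} (ht : 0 < t) :
    Integrable (fun x : ℝ => (x ^ 2 + t ^ 2)⁻¹) volume := by
  simp only [inv_sq_add_sq_eq ht]
  exact (integrable_inv_one_add_sq.comp_div ht.ne').const_mul _

theorem integral_inv_sq_add_sq {t : ℝ} (ht : 0 < t) :
    ∫ x : ℝ, (x ^ 2 + t ^ 2)⁻¹ = Real.pi / t := by
  simp only [inv_sq_add_sq_eq ht]
  rw [integral_const_mul, Measure.integral_comp_div (fun x => (1 + x ^ 2)⁻¹) t,
    integral_univ_inv_one_add_sq, abs_of_pos ht, smul_eq_mul]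
  field_simp

theorem memLp_inv_sub_imagPt {σ t : ℝ} (hσ : σ ^ 2 = 1) (ht : 0 < t) :
    MemLp (fun x : ℝ => ((x : ℂ) - imagPt σ t)⁻¹) 2 volume := by
  rw [memLp_two_iff_integrable_sq_norm (continuous_inv_sub_imagPt hσ ht).aestronglyMeasurable]
  simp only [norm_inv_sub_imagPt_sq hσ]
  exact integrable_inv_sq_add_sq ht

/-- The function `1 / (x - σ t i)` as an element of `L²(ℝ)`. -/
def cauchy {σ t : ℝ} (hσ : σ ^ 2 = 1) (ht : 0 < t) : L2 := (memLp_inv_sub_imagPt hσ ht).toLp _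

theorem cauchy_ae {σ t : ℝ} (hσ : σ ^ 2 = 1) (ht : 0 < t) :
    cauchy hσ ht =ᵐ[volume] fun x : ℝ => ((x : ℂ) - imagPt σ t)⁻¹ :=
  (memLp_inv_sub_imagPt hσ ht).coeFn_toLp

theorem norm_cauchy {σ t : ℝ} (hσ : σ ^ 2 = 1) (ht : 0 < t) :
    ‖cauchy hσ ht‖ = √(Real.pi / t) := by
  have h : ((‖cauchy hσ ht‖ ^ 2 : ℝ) : ℂ) = ((Real.pi / t : ℝ) : ℂ) := by
    rw [← integral_inv_sq_add_sq ht, ← integral_complex_ofReal]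
    push_cast
    rw [← Complex.coe_algebraMap, ← inner_self_eq_norm_sq_to_K (𝕜 := ℂ), L2.inner_def]
    refine integral_congr_ae ?_
    filter_upwards [cauchy_ae hσ ht] with x hx
    rw [hx, inner_self_eq_norm_sq_to_K]
    have := norm_inv_sub_imagPt_sq hσ t x
    rw [← Complex.ofReal_inj] at this
    push_cast at this
    simpa using this
  rw [Complex.ofReal_inj] at h
  rw [← h, Real.sqrt_sq (norm_nonneg _)]

theorem memLp_cauchyMul {σ t : ℝ} (hσ : σ ^ 2 = 1) (ht : 0 < t) (g : L2) :
    MemLp (fun x : ℝ => ((x : ℂ) - imagPt σ t)⁻¹ * g x) 2 volume := by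
  refine MemLp.of_le_mul (c := t⁻¹) (Lp.memLp g)
    ((continuous_inv_sub_imagPt hσ ht).aestronglyMeasurable.mul (Lp.aestronglyMeasurable g))
    (.of_forall fun x => ?_)
  rw [norm_mul]
  gcongr
  exact norm_inv_sub_imagPt_le hσ ht x

/-- Multiplication by `1 / (x - σ t i)` on `L²(ℝ)`. -/
def cauchyMul {σ t : ℝ} (hσ : σ ^ 2 = 1) (ht : 0 < t) : L2 →L[ℂ] L2 :=
  LinearMap.mkContinuous
    { toFun := fun g => (memLp_cauchyMul hσ ht g).toLp _
      map_add' := by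
        intro f g
        rw [← MemLp.toLp_add]
        refine MemLp.toLp_congr _ _ ?_
        filter_upwards [Lp.coeFn_add f g] with x hx
        simp only [hx, Pi.add_apply]
        ring
      map_smul' := by
        intro k f
        rw [RingHom.id_apply, ← MemLp.toLp_const_smul]
        refine MemLp.toLp_congr _ _ ?_
        filter_upwards [Lp.coeFn_smul k f] with x hx
        simp only [hx, Pi.smul_apply, smul_eq_mul]
        ring }
    t⁻¹ fun g => by
      refine Lp.norm_le_mul_norm_of_ae_le_mul ?_
      filter_upwards [(memLp_cauchyMul hσ ht g).coeFn_toLp] with x hx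
      simp only [LinearMap.coe_mk, AddHom.coe_mk]
      rw [hx, norm_mul]
      gcongr
      exact norm_inv_sub_imagPt_le hσ ht x

theorem cauchyMul_ae {σ t : ℝ} (hσ : σ ^ 2 = 1) (ht : 0 < t) (g : L2) :
    cauchyMul hσ ht g =ᵐ[volume] fun x : ℝ => ((x : ℂ) - imagPt σ t)⁻¹ * g x :=
  (memLp_cauchyMul hσ ht g).coeFn_toLp

theorem norm_cauchyMul_le {σ t : ℝ} (hσ : σ ^ 2 = 1) (ht : 0 < t) (g : L2) :
    ‖cauchyMul hσ ht g‖ ≤ t⁻¹ * ‖g‖ :=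
  (cauchyMul hσ ht).le_of_opNorm_le
    (LinearMap.mkContinuous_norm_le _ (inv_nonneg.2 ht.le) _) g

theorem neg_sq_eq_one {σ : ℝ} (hσ : σ ^ 2 = 1) : (-σ) ^ 2 = 1 := by rw [neg_sq, hσ]

theorem inner_cauchy_ae {σ t : ℝ} (hσ : σ ^ 2 = 1) (ht : 0 < t) (g : L2) :
    (fun x => inner ℂ (cauchy (neg_sq_eq_one hσ) ht x) (g x)) =ᵐ[volume] cauchyMul hσ ht g := by
  filter_upwards [cauchy_ae (neg_sq_eq_one hσ) ht, cauchyMul_ae hσ ht g] with x h1 h2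
  rw [h1, h2, RCLike.inner_apply, mul_comm]
  congr 1
  simp [imagPt, sub_eq_add_neg]

/-- With `w = σ t i`, the conjugate of `1 / (x + w)` is `1 / (x - w)`, so the integral is an inner
product; and `x / (x - w) = 1 + w / (x - w)` keeps `x` times the function in `L²`. -/
theorem hasTraces_cauchyMul {σ t : ℝ} (hσ : σ ^ 2 = 1) (ht : 0 < t) (g : L2) :
    HasTraces (cauchyMul hσ ht g) (inner ℂ (cauchy (neg_sq_eq_one hσ) ht) g) 0 := by
  constructor
  · have hi := (L2.integrable_inner (𝕜 := ℂ) (cauchy (neg_sq_eq_one hσ) ht) g).congr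
      (inner_cauchy_ae hσ ht g)
    rw [L2.inner_def, integral_congr_ae (inner_cauchy_ae hσ ht g)]
    exact intervalIntegral_tendsto_integral hi tendsto_neg_atTop_atBot tendsto_id
  · refine (Lp.memLp (g + imagPt σ t • cauchyMul hσ ht g)).ae_eq ?_
    filter_upwards [cauchyMul_ae hσ ht g, Lp.coeFn_add g (imagPt σ t • cauchyMul hσ ht g),
      Lp.coeFn_smul (imagPt σ t) (cauchyMul hσ ht g)] with x h1 h2 h3
    rw [h2, Pi.add_apply, h3, Pi.smul_apply, h1, smul_eq_mul]
    have := sub_imagPt_ne_zero hσ ht x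
    field_simp
    ring

theorem inv_sub_imagPt_eq {σ t : ℝ} (hσ : σ ^ 2 = 1) (ht : 0 < t) (x : ℝ) :
    ((x : ℂ) - imagPt σ t)⁻¹ =
      ((x * (x ^ 2 + t ^ 2)⁻¹ : ℝ) : ℂ) + imagPt σ t * (((x ^ 2 + t ^ 2)⁻¹ : ℝ) : ℂ) := by
  have h1 := sub_imagPt_ne_zero hσ ht x
  have h2 : ((x : ℂ) ^ 2 + (t : ℂ) ^ 2) ≠ 0 := by
    have : 0 < x ^ 2 + t ^ 2 := by positivity
    exact_mod_cast this.ne'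
  have h3 : imagPt σ t ^ 2 = -(t : ℂ) ^ 2 := by
    have : ((σ : ℂ)) ^ 2 = 1 := by exact_mod_cast hσ
    simp only [imagPt, mul_pow, Complex.I_sq]
    push_cast
    linear_combination (-(t : ℂ) ^ 2) * this
  push_cast
  refine inv_eq_of_mul_eq_one_left ?_
  field_simp
  linear_combination -h3

/-- Over symmetric intervals the odd part `x / (x² + t²)` cancels, and the even part contributes `σ
t i · π / t`, independent of `t`. -/
theorem hasTraces_cauchy {σ t : ℝ} (hσ : σ ^ 2 = 1) (ht : 0 < t) :
    HasTraces (cauchy hσ ht) (σ * Real.pi * Complex.I) 1 := by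
  constructor
  · have hodd : ∀ R : ℝ, ∫ x in (-R)..R, x * (x ^ 2 + t ^ 2)⁻¹ = 0 := by
      intro R
      have h := intervalIntegral.integral_comp_neg (a := -R) (b := R)
        (fun x : ℝ => x * (x ^ 2 + t ^ 2)⁻¹)
      simp only [neg_sq, neg_mul, neg_neg, intervalIntegral.integral_neg] at h
      linarith
    have hR : ∀ R : ℝ, ∫ x in (-R)..R, cauchy hσ ht x =
        imagPt σ t * ∫ x in (-R)..R, (((x ^ 2 + t ^ 2)⁻¹ : ℝ) : ℂ) := by
      intro R
      have hc : Continuous fun x : ℝ => (x ^ 2 + t ^ 2)⁻¹ :=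
        Continuous.inv₀ (by fun_prop) fun x => by positivity
      rw [intervalIntegral.integral_congr_ae
        (g := fun x => ((x * (x ^ 2 + t ^ 2)⁻¹ : ℝ) : ℂ) +
          imagPt σ t * (((x ^ 2 + t ^ 2)⁻¹ : ℝ) : ℂ)),
        intervalIntegral.integral_add, intervalIntegral.integral_ofReal, hodd,
        intervalIntegral.integral_const_mul]
      · simp
      · exact Continuous.intervalIntegrable (by fun_prop) _ _
      · exact Continuous.intervalIntegrable (by fun_prop) _ _
      · filter_upwards [cauchy_ae hσ ht] with x hx _
        rw [hx, inv_sub_imagPt_eq hσ ht]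
    simp only [hR]
    have h := intervalIntegral_tendsto_integral ((integrable_inv_sq_add_sq ht).ofReal (𝕜 := ℂ))
      tendsto_neg_atTop_atBot tendsto_id
    have e : imagPt σ t * ∫ x : ℝ, (((x ^ 2 + t ^ 2)⁻¹ : ℝ) : ℂ) = σ * Real.pi * Complex.I := by
      rw [integral_complex_ofReal, integral_inv_sq_add_sq ht, imagPt]
      have : (t : ℂ) ≠ 0 := by exact_mod_cast ht.ne'
      push_cast
      field_simp
    rw [← e]
    exact h.const_mul _
  · refine ((memLp_inv_sub_imagPt hσ ht).const_mul (imagPt σ t)).ae_eq ?_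
    filter_upwards [cauchy_ae hσ ht] with x h1
    rw [h1]
    have := sub_imagPt_ne_zero hσ ht x
    field_simp
    ring

/-- Divide by `x - σ t i`. The equation remains implicit, since `u` also enters through `⟨u, φ⟩`. -/
theorem maxRel_iff_eq_cauchyMul {σ t : ℝ} (hσ : σ ^ 2 = 1) (ht : 0 < t) (φ ψ u g : L2) (c : ℂ) :
    MaxRel φ ψ u (g + imagPt σ t • u) c ↔
      u = cauchyMul hσ ht (g - inner ℂ φ u • ψ) + c • cauchy hσ ht := by
  set k := inner ℂ φ u with hk
  rw [Lp.ext_iff]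
  refine eventually_congr ?_
  filter_upwards [Lp.coeFn_add g (imagPt σ t • u), Lp.coeFn_smul (imagPt σ t) u,
    Lp.coeFn_add (cauchyMul hσ ht (g - k • ψ)) (c • cauchy hσ ht),
    cauchyMul_ae hσ ht (g - k • ψ), Lp.coeFn_smul c (cauchy hσ ht), cauchy_ae hσ ht,
    Lp.coeFn_sub g (k • ψ), Lp.coeFn_smul k ψ] with x h1 h2 h3 h4 h5 h6 h7 h8
  rw [h1, h3, Pi.add_apply, h2, Pi.add_apply, h4, h5, h7, Pi.sub_apply, h8, Pi.smul_apply,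
    Pi.smul_apply, Pi.smul_apply, h6, smul_eq_mul, smul_eq_mul, smul_eq_mul]
  have := sub_imagPt_ne_zero hσ ht x
  rw [show ((x : ℂ) - imagPt σ t)⁻¹ * (g x - k * ψ x) + c * ((x : ℂ) - imagPt σ t)⁻¹ =
    (g x - k * ψ x + c) / ((x : ℂ) - imagPt σ t) by ring, eq_div_iff this]
  constructor <;> intro h <;> linear_combination -h

theorem MaxRel.trace_eq {σ t : ℝ} (hσ : σ ^ 2 = 1) (ht : 0 < t) {φ ψ u g : L2} {c : ℂ}
    (h : MaxRel φ ψ u (g + imagPt σ t • u) c) :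
    HasTraces u (inner ℂ (cauchy (neg_sq_eq_one hσ) ht) (g - inner ℂ φ u • ψ) +
      c * (σ * Real.pi * Complex.I)) c := by
  have h1 := (hasTraces_cauchyMul hσ ht (g - inner ℂ φ u • ψ)).add ((hasTraces_cauchy hσ ht).smul c)
  rw [← (maxRel_iff_eq_cauchyMul hσ ht φ ψ u g c).1 h, zero_add, mul_one] at h1
  exact h1

/-! ### Resolvents and defect elements far out on the imaginary axis -/

/-- The resolvent of `A_B` at `σ t i` for `φ = ψ = 0`. -/
def freeResolvent {σ t : ℝ} (hσ : σ ^ 2 = 1) (ht : 0 < t) (B : ℂ) : L2 →L[ℂ] L2 :=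
  cauchyMul hσ ht - (σ * Real.pi * Complex.I - B)⁻¹ •
    (innerSL ℂ (cauchy (neg_sq_eq_one hσ) ht)).smulRight (cauchy hσ ht)

theorem freeResolvent_apply {σ t : ℝ} (hσ : σ ^ 2 = 1) (ht : 0 < t) (B : ℂ) (g : L2) :
    freeResolvent hσ ht B g = cauchyMul hσ ht g +
      (-((σ * Real.pi * Complex.I - B)⁻¹ * inner ℂ (cauchy (neg_sq_eq_one hσ) ht) g)) •
        cauchy hσ ht := by
  simp [freeResolvent, sub_eq_add_neg, mul_smul]

theorem norm_freeResolvent_apply_le {σ t : ℝ} (hσ : σ ^ 2 = 1) (ht : 0 < t) (B : ℂ) (g : L2) :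
    ‖freeResolvent hσ ht B g‖ ≤ (1 + ‖(σ * Real.pi * Complex.I - B)⁻¹‖ * Real.pi) * ‖g‖ * t⁻¹ := by
  rw [freeResolvent_apply]
  refine (norm_add_le _ _).trans ?_
  rw [norm_smul, norm_neg, norm_mul, norm_cauchy]
  have h1 := norm_cauchyMul_le hσ ht g
  have h2 := norm_inner_le_norm (𝕜 := ℂ) (cauchy (neg_sq_eq_one hσ) ht) g
  rw [norm_cauchy] at h2
  have h3 : √(Real.pi / t) * √(Real.pi / t) = Real.pi * t⁻¹ := by
    rw [Real.mul_self_sqrt (by positivity), div_eq_mul_inv]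
  calc _ ≤ t⁻¹ * ‖g‖ + ‖(σ * Real.pi * Complex.I - B)⁻¹‖ * (√(Real.pi / t) * ‖g‖) *
        √(Real.pi / t) := by gcongr
    _ = _ := by linear_combination ‖(σ * Real.pi * Complex.I - B)⁻¹‖ * ‖g‖ * h3

/-- The traces turn the boundary condition into a linear equation for `c` with coefficient `σ π i -
B`, which is invertible by `hB`. -/
theorem bdry_maxRel_iff {σ t : ℝ} (hσ : σ ^ 2 = 1) (ht : 0 < t) {B : ℂ}
    (hB : B ≠ σ * Real.pi * Complex.I) (φ ψ u g : L2) :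
    (∃ a c, HasTraces u a c ∧ a = B * c ∧ MaxRel φ ψ u (g + imagPt σ t • u) c) ↔
      u = freeResolvent hσ ht B (g - inner ℂ φ u • ψ) := by
  have hB' : (σ * Real.pi * Complex.I - B) ≠ 0 := sub_ne_zero.2 hB.symm
  rw [freeResolvent_apply]
  constructor
  · rintro ⟨a, c, ht', hac, hr⟩
    have hc := (ht'.unique (hr.trace_eq hσ ht)).1
    have := (maxRel_iff_eq_cauchyMul hσ ht φ ψ u g c).1 hr
    rw [hac] at hc
    rw [← show c = -((σ * Real.pi * Complex.I - B)⁻¹ *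
      inner ℂ (cauchy (neg_sq_eq_one hσ) ht) (g - inner ℂ φ u • ψ)) by
        field_simp
        linear_combination -hc]
    exact this
  · intro h
    have hr := (maxRel_iff_eq_cauchyMul hσ ht φ ψ u g _).2 h
    refine ⟨_, _, hr.trace_eq hσ ht, ?_, hr⟩
    field_simp
    ring

/-- The equation for `u` is `u + ⟨u, φ⟩ R₀ ψ = R₀ g`. Since `‖R₀ ψ‖ = O(1/t)`, a Neumann series
inverts the left side for large `t`. -/
theorem eventually_mem_resolventSet (φ ψ : L2) {σ : ℝ} (hσ : σ ^ 2 = 1) {B : ℂ}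
    (hB : B ≠ σ * Real.pi * Complex.I) :
    ∀ᶠ t in atTop, imagPt σ t ∈ resolventSet (bdryOp φ ψ B) := by
  set C := ‖φ‖ * ((1 + ‖(σ * Real.pi * Complex.I - B)⁻¹‖ * Real.pi) * ‖ψ‖)
  have hC : ∀ᶠ t : ℝ in atTop, C * t⁻¹ < 1 := by
    have := (tendsto_inv_atTop_zero (𝕜 := ℝ)).const_mul C
    rw [mul_zero] at this
    exact this.eventually (gt_mem_nhds one_pos)
  filter_upwards [hC, eventually_gt_atTop 0] with t htC ht
  set R₀ := freeResolvent hσ ht B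
  set T : L2 →L[ℂ] L2 := -(innerSL ℂ φ).smulRight (R₀ ψ) with hT
  have hTn : ‖T‖ < 1 := by
    refine lt_of_le_of_lt ?_ htC
    rw [hT, norm_neg, ContinuousLinearMap.norm_smulRight_apply, innerSL_apply_norm, mul_assoc]
    gcongr
    exact norm_freeResolvent_apply_le hσ ht B ψ
  set U := Units.oneSub T hTn with hU
  have hUa : ∀ u, (U : L2 →L[ℂ] L2) u = u + inner ℂ φ u • R₀ ψ := fun u => by
    simp [hU, hT]
  have key : ∀ u g, (∃ a c, HasTraces u a c ∧ a = B * c ∧ MaxRel φ ψ u (g + imagPt σ t • u) c) ↔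
      (U : L2 →L[ℂ] L2) u = R₀ g := fun u g => by
    rw [bdry_maxRel_iff hσ ht hB, hUa, map_sub, map_smul, eq_sub_iff_add_eq]
  refine ⟨(↑U⁻¹ : L2 →L[ℂ] L2) * R₀, (isResolventAt_bdryOp_iff φ ψ B _ _).2 ⟨fun g => ?_, ?_⟩⟩
  · rw [key, ← mul_apply_eq_comp, ← mul_assoc, U.mul_inv, one_mul]
  · intro u g h
    rw [key] at h
    rw [mul_apply_eq_comp, ← h, ← mul_apply_eq_comp, U.inv_mul,
      one_apply_eq_self]

/-- A defect element is `c / (x - σ t i)` minus `⟨u, φ⟩ ψ / (x - σ t i)`. For large `t` the second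
term has norm at most `‖u‖ / 2` and is absorbed; its `Γ₁` is the error in `a ≈ σ π i c`. -/
theorem eventually_defect_estimate (φ ψ : L2) {σ : ℝ} (hσ : σ ^ 2 = 1) :
    ∀ᶠ t in atTop, ∀ u ∈ defectSpace φ ψ (imagPt σ t), ∀ a c : ℂ, HasTraces u a c →
      ‖u‖ ≤ 2 * ‖c‖ * √(Real.pi / t) ∧
        ‖a - c * (σ * Real.pi * Complex.I)‖ ≤ 2 * (‖φ‖ * ‖ψ‖) * (Real.pi / t) * ‖c‖ := by
  have hC : ∀ᶠ t : ℝ in atTop, ‖φ‖ * ‖ψ‖ * t⁻¹ < 1 / 2 := by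
    have := (tendsto_inv_atTop_zero (𝕜 := ℝ)).const_mul (‖φ‖ * ‖ψ‖)
    rw [mul_zero] at this
    exact this.eventually (gt_mem_nhds one_half_pos)
  filter_upwards [hC, eventually_gt_atTop 0] with t htC ht u hu a c hac
  obtain ⟨d, hd⟩ := (mem_defectSpace_iff φ ψ _ u).1 hu
  obtain rfl := traceConst_unique hac.2 hd.memLp
  rw [← zero_add (imagPt σ t • u)] at hd
  have ha := (hac.unique (hd.trace_eq hσ ht)).1
  have hu' := (maxRel_iff_eq_cauchyMul hσ ht φ ψ u 0 c).1 hd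
  have hk := norm_inner_le_norm (𝕜 := ℂ) φ u
  have hE : √(Real.pi / t) * √(Real.pi / t) = Real.pi / t := Real.mul_self_sqrt (by positivity)
  have hn : ‖u‖ ≤ 2 * ‖c‖ * √(Real.pi / t) := by
    have h1 : ‖u‖ ≤ t⁻¹ * (‖φ‖ * ‖u‖ * ‖ψ‖) + ‖c‖ * √(Real.pi / t) := by
      conv_lhs => rw [hu']
      refine (norm_add_le _ _).trans ?_
      rw [norm_smul, norm_cauchy]
      gcongr
      refine (norm_cauchyMul_le hσ ht _).trans ?_
      rw [zero_sub, norm_neg, norm_smul]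
      gcongr
    nlinarith [norm_nonneg u]
  refine ⟨hn, ?_⟩
  rw [ha, add_sub_cancel_right, zero_sub, inner_neg_right, norm_neg, inner_smul_right, norm_mul]
  have h2 := norm_inner_le_norm (𝕜 := ℂ) (cauchy (neg_sq_eq_one hσ) ht) ψ
  rw [norm_cauchy] at h2
  calc _ ≤ ‖φ‖ * (2 * ‖c‖ * √(Real.pi / t)) * (√(Real.pi / t) * ‖ψ‖) := by
        gcongr
        exact hk.trans (by gcongr)
    _ = _ := by linear_combination 2 * ‖φ‖ * ‖c‖ * ‖ψ‖ * hE

theorem maxRel_of_hasTraces_zero {φ ψ u : L2} {a : ℂ} (h : HasTraces u a 0) :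
    ∃ v, MaxRel φ ψ u v 0 := by
  have hm : MemLp (fun x : ℝ => (x : ℂ) * u x) 2 volume := by simpa using h.2
  refine ⟨hm.toLp _ + inner ℂ φ u • ψ, ?_⟩
  filter_upwards [Lp.coeFn_add (hm.toLp _) (inner ℂ φ u • ψ), hm.coeFn_toLp,
    Lp.coeFn_smul (inner ℂ φ u) ψ] with x h1 h2 h3
  rw [h1, Pi.add_apply, h2, h3, Pi.smul_apply, smul_eq_mul, sub_zero]

/-! ### Real points lie in no resolvent set -/

/-- A nonzero function supported near the real point `r` which is orthogonal to `φ` and has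
integral zero. -/
theorem exists_localized (φ : L2) (r : ℝ) {ε : ℝ} (hε : 0 < ε) :
    ∃ f : L2, f ≠ 0 ∧ inner ℂ φ f = 0 ∧ HasTraces f 0 0 ∧
      ∀ᵐ x : ℝ, ‖((x : ℂ) - r) * f x‖ ≤ ε * ‖f x‖ := by
  -- Three disjoint intervals inside `[r, r + ε]`: three coefficients against two linear conditions
  -- leave a nonzero combination.
  set s : Fin 3 → Set ℝ := fun i => Set.Icc (r + ε * (2 * i) / 6) (r + ε * (2 * i + 1) / 6) with hs
  have hsc : ∀ i, IsCompact (s i) := fun i => isCompact_Icc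
  have hvol : ∀ i, volume.real (s i) = ε / 6 := fun i => by
    rw [hs, Real.volume_real_Icc_of_le]
    · ring
    · gcongr
      linarith
  set F : (Fin 3 → ℂ) →ₗ[ℂ] L2 := Fintype.linearCombination ℂ fun i => compactIndicator (hsc i)
    with hF
  have hFa : ∀ α, F α = ∑ i, α i • compactIndicator (hsc i) := fun α =>
    Fintype.linearCombination_apply _ _ _
  set T : (Fin 3 → ℂ) →ₗ[ℂ] (Fin 2 → ℂ) :=
    LinearMap.pi ![(innerSL ℂ φ : L2 →L[ℂ] ℂ).toLinearMap ∘ₗ F,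
      ∑ i, LinearMap.proj i] with hT
  obtain ⟨α, hα, hα0⟩ := (Submodule.ne_bot_iff _).1
    (T.ker_ne_bot_of_finrank_lt (by simp))
  have hT0 : inner ℂ φ (F α) = 0 := by simpa [hT] using congrFun (LinearMap.mem_ker.1 hα) 0
  have hT1 : ∑ i, α i = 0 := by simpa [hT] using congrFun (LinearMap.mem_ker.1 hα) 1
  have hae : ∀ᵐ x : ℝ, F α x = ∑ i, α i * (s i).indicator (fun _ => (1 : ℂ)) x := by
    rw [hFa, Fin.sum_univ_three]
    filter_upwards [compactIndicator_ae (hsc 0), compactIndicator_ae (hsc 1),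
      compactIndicator_ae (hsc 2), Lp.coeFn_smul (α 0) (compactIndicator (hsc 0)),
      Lp.coeFn_smul (α 1) (compactIndicator (hsc 1)),
      Lp.coeFn_smul (α 2) (compactIndicator (hsc 2)),
      Lp.coeFn_add (α 0 • compactIndicator (hsc 0)) (α 1 • compactIndicator (hsc 1)),
      Lp.coeFn_add (α 0 • compactIndicator (hsc 0) + α 1 • compactIndicator (hsc 1))
        (α 2 • compactIndicator (hsc 2))] with x h0 h1 h2 h3 h4 h5 h6 h7
    simp only [h7, h6, h5, h4, h3, h2, h1, h0, Pi.add_apply, Pi.smul_apply, smul_eq_mul,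
      Fin.sum_univ_three]
  have hdisj : ∀ i j, i ≠ j → Disjoint (s i) (s j) := by
    intro i j hij
    rw [Set.disjoint_left]
    intro x hi hj
    simp only [hs, Set.mem_Icc] at hi hj
    have key : ∀ p q : ℝ, p + 1 ≤ q → r + ε * (2 * q) / 6 ≤ x → x ≤ r + ε * (2 * p + 1) / 6 →
        False := by
      intro p q hpq h1 h2
      nlinarith
    rcases lt_or_gt_of_ne hij with h | h
    · exact key i j (by exact_mod_cast h) hj.1 hi.2
    · exact key j i (by exact_mod_cast h) hi.1 hj.2
  refine ⟨F α, ?_, hT0, ?_, ?_⟩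
  · intro h0
    apply hα0
    funext j
    have h1 : ∀ᵐ x : ℝ, x ∈ s j → α j = 0 := by
      filter_upwards [hae, Lp.coeFn_zero ℂ 2 (volume : Measure ℝ)] with x hx hz hxj
      rw [h0, hz, Finset.sum_eq_single j] at hx
      · simpa [hxj] using hx.symm
      · intro i _ hij
        simp [Set.disjoint_right.1 (hdisj i j hij) hxj]
      · simp
    by_contra hj
    have h2 : volume (s j) = 0 := by
      refine measure_mono_null (fun x hx => ?_) h1
      exact fun hx' => hj (hx' hx)
    have h3 := hvol j
    rw [measureReal_def, h2] at h3
    simp at h3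
    linarith
  · have h := (((hasTraces_compactIndicator (hsc 0)).smul (α 0)).add
      ((hasTraces_compactIndicator (hsc 1)).smul (α 1))).add
      ((hasTraces_compactIndicator (hsc 2)).smul (α 2))
    rw [hFa, Fin.sum_univ_three]
    rw [hvol, hvol, hvol] at h
    rw [Fin.sum_univ_three] at hT1
    convert h using 1
    · linear_combination (-(ε / 6 : ℝ) : ℂ) * hT1
    · ring
  · filter_upwards [hae] with x hx
    by_cases h : ∃ i, x ∈ s i
    · obtain ⟨i, hi⟩ := h
      rw [norm_mul]
      gcongr
      rw [← Complex.ofReal_sub, Complex.norm_real, Real.norm_eq_abs, abs_le]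
      have h1 : ((i : ℕ) : ℝ) ≤ 2 := by exact_mod_cast Nat.le_of_lt_succ i.2
      have h2 : (0 : ℝ) ≤ ((i : ℕ) : ℝ) := by positivity
      simp only [hs, Set.mem_Icc] at hi
      constructor <;> nlinarith
    · push Not at h
      rw [hx, Finset.sum_eq_zero fun i _ => by simp [h i]]
      simp

/-- The localized functions have zero traces, so they lie in the domain of `A_B` for every `B`, and
they are approximate eigenvectors at any real point. -/
theorem im_ne_zero_of_mem_resolventSet {φ ψ : L2} {B z : ℂ}
    (hz : z ∈ resolventSet (bdryOp φ ψ B)) : z.im ≠ 0 := by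
  intro him
  obtain ⟨R, hR⟩ := hz
  obtain ⟨-, hR2⟩ := (isResolventAt_bdryOp_iff φ ψ B z R).1 hR
  have hzr : z = (z.re : ℂ) := Complex.ext rfl (by simpa using him)
  have hε : 0 < (2 * (‖R‖ + 1))⁻¹ := by positivity
  obtain ⟨f, hf0, hφ, htr, hb⟩ := exists_localized φ z.re hε
  obtain ⟨v, hv⟩ := maxRel_of_hasTraces_zero (φ := φ) (ψ := ψ) htr
  have hRf : R (v - z • f) = f :=
    hR2 f (v - z • f) ⟨0, 0, htr, by simp, by simpa using hv⟩
  have hn : ‖v - z • f‖ ≤ (2 * (‖R‖ + 1))⁻¹ * ‖f‖ := by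
    refine Lp.norm_le_mul_norm_of_ae_le_mul ?_
    filter_upwards [hv, hb, Lp.coeFn_sub v (z • f), Lp.coeFn_smul z f] with x h1 h2 h3 h4
    rw [h3, Pi.sub_apply, h4, Pi.smul_apply, h1, hφ, smul_eq_mul]
    rw [← hzr] at h2
    rwa [show (x : ℂ) * f x - 0 + 0 * ψ x - z * f x = ((x : ℂ) - z) * f x by ring]
  have hf : 0 < ‖f‖ := norm_pos_iff.2 hf0
  have h1 : ‖f‖ ≤ ‖R‖ * ((2 * (‖R‖ + 1))⁻¹ * ‖f‖) := by
    conv_lhs => rw [← hRf]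
    exact (R.le_opNorm _).trans (by gcongr)
  have h2 : ‖R‖ * (2 * (‖R‖ + 1))⁻¹ < 1 := by
    rw [← div_eq_mul_inv, div_lt_one (by positivity)]
    linarith [norm_nonneg R]
  nlinarith

/-! ### Normalised defect elements and the `M`-function -/

theorem exists_hasTraces_one : ∃ w : L2, HasTraces w 1 0 := by
  refine ⟨_, by simpa using hasTraces_compactIndicator (isCompact_Icc (a := (0 : ℝ)) (b := 1))⟩

theorem MaxRel.sub_smul_defect {φ ψ u v : L2} {c z : ℂ} (h : MaxRel φ ψ u v c) {f : L2} {d : ℂ}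
    (hf : MaxRel φ ψ f ((v - z • u) + z • f) d) :
    MaxRel φ ψ (u + (-1 : ℂ) • f) (z • (u + (-1 : ℂ) • f)) (c + -1 * d) := by
  have := h.add (hf.smul (-1))
  convert this using 1
  module

/-- Take `w` with traces `(1, 0)` and subtract `(A_B - z)⁻¹ (Ã* - z) w`, which satisfies the
boundary condition. -/
theorem exists_normalized_defect {φ ψ : L2} {B z : ℂ} (hz : z ∈ resolventSet (bdryOp φ ψ B)) :
    ∃ u ∈ defectSpace φ ψ z, ∃ a c : ℂ, HasTraces u a c ∧ a - B * c = 1 := by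
  obtain ⟨R, hR⟩ := hz
  obtain ⟨hR1, -⟩ := (isResolventAt_bdryOp_iff φ ψ B z R).1 hR
  obtain ⟨w, hw⟩ := exists_hasTraces_one
  obtain ⟨v, hv⟩ := maxRel_of_hasTraces_zero (φ := φ) (ψ := ψ) hw
  obtain ⟨a, c, ht, hac, hr⟩ := hR1 (v - z • w)
  refine ⟨_, (mem_defectSpace_iff φ ψ z _).2 ⟨_, hv.sub_smul_defect hr⟩, _, _,
    hw.add (ht.smul (-1)), ?_⟩
  rw [hac]
  ring

theorem HasTraces.eq_zero_of_mem_defectSpace {φ ψ u : L2} {B z a c : ℂ}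
    (hz : z ∈ resolventSet (bdryOp φ ψ B)) (hu : u ∈ defectSpace φ ψ z) (h : HasTraces u a c)
    (hac : a - B * c = 0) : u = 0 := by
  obtain ⟨R, hR⟩ := hz
  obtain ⟨-, hR2⟩ := (isResolventAt_bdryOp_iff φ ψ B z R).1 hR
  obtain ⟨d, hd⟩ := (mem_defectSpace_iff φ ψ z u).1 hu
  obtain rfl := traceConst_unique h.2 hd.memLp
  rw [← hR2 u 0 ⟨a, c, h, sub_eq_zero.1 hac, by simpa using hd⟩, map_zero]

/-- The normalised defect element spans the defect space, because the resolvent excludes nonzero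
defect elements satisfying the boundary condition; `m` is its `Γ₂`. -/
theorem exists_isMValue {φ ψ : L2} {B z : ℂ} (hz : z ∈ resolventSet (bdryOp φ ψ B)) :
    ∃ m, IsMValue φ ψ B z m := by
  obtain ⟨u, hu, a, c, ht, hac⟩ := exists_normalized_defect hz
  obtain ⟨d, hd⟩ := (mem_defectSpace_iff φ ψ z u).1 hu
  refine ⟨c, fun h k => ⟨?_, ?_⟩⟩
  · rintro rfl
    refine ⟨h • u, (mem_defectSpace_iff φ ψ z _).2 ⟨h * d, ?_⟩, _, _, ht.smul h, ?_, mul_comm _ _⟩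
    · rw [smul_comm]
      exact hd.smul h
    · linear_combination h * hac
  · rintro ⟨u', hu', a', k, ht', hac', rfl⟩
    obtain ⟨d', hd'⟩ := (mem_defectSpace_iff φ ψ z u').1 hu'
    have hw : u' + (-h) • u ∈ defectSpace φ ψ z := by
      refine (mem_defectSpace_iff φ ψ z _).2 ⟨d' + -h * d, ?_⟩
      rw [smul_add, smul_comm z]
      exact hd'.add (hd.smul (-h))
    have htw := ht'.add (ht.smul (-h))
    have h0 := htw.eq_zero_of_mem_defectSpace hz hw (by linear_combination hac' - h * hac)
    rw [h0] at htw
    have := (htw.unique HasTraces.zero).2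
    linear_combination this

theorem IsMValue.eq_of_hasTraces {φ ψ u : L2} {B z m a c : ℂ} (hm : IsMValue φ ψ B z m)
    (hu : u ∈ defectSpace φ ψ z) (h : HasTraces u a c) (hac : a - B * c = 1) : m = c := by
  have := (hm 1 c).2 ⟨u, hu, a, c, h, hac, rfl⟩
  rw [this, mul_one]

/-! ### Comparison of two models with the same restricted resolvents -/

theorem IsResolventAt.mem_restrictedResolvents {φ ψ g : L2} {B z : ℂ} {R : L2 →L[ℂ] L2}
    (hR : IsResolventAt (bdryOp φ ψ B) z R) (hg : g ∈ detectable φ ψ) :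
    (z, g, R g) ∈ restrictedResolvents φ ψ B :=
  ⟨im_ne_zero_of_mem_resolventSet ⟨R, hR⟩, hg, R, hR, rfl⟩

theorem defectSpace_subset_detectable {φ ψ u : L2} {B z : ℂ}
    (hz : z ∈ resolventSet (bdryOp φ ψ B)) (hu : u ∈ defectSpace φ ψ z) : u ∈ detectable φ ψ :=
  Submodule.le_topologicalClosure _ (Submodule.subset_span ⟨z, B, hz, hu⟩)

theorem mem_resolventSet_of_restrictedResolvents_eq {φ ψ φ' ψ' : L2} {B B' z : ℂ}
    (hF : restrictedResolvents φ ψ B = restrictedResolvents φ' ψ' B')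
    (hz : z ∈ resolventSet (bdryOp φ ψ B)) : z ∈ resolventSet (bdryOp φ' ψ' B') := by
  obtain ⟨R, hR⟩ := hz
  have h := hR.mem_restrictedResolvents (zero_mem (detectable φ ψ))
  rw [hF] at h
  obtain ⟨-, -, R', hR', -⟩ := h
  exact ⟨R', hR'⟩

/-- Continuation of a defect element `u` from `z` to `w`, when two models have the same family of
restricted resolvents: the continued element has the form `u + (w - z) f`, where `f` satisfies
both boundary conditions and both perturbations agree on `f`. -/
theorem exists_defect_continuation {φ ψ φ' ψ' : L2} {B B' z w : ℂ}
    (hF : restrictedResolvents φ ψ B = restrictedResolvents φ' ψ' B')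
    (hz : z ∈ resolventSet (bdryOp φ ψ B)) (hw : w ∈ resolventSet (bdryOp φ ψ B))
    {u : L2} (hu : u ∈ defectSpace φ ψ z) :
    ∃ f : L2, u + (w - z) • f ∈ defectSpace φ ψ w ∧
      inner ℂ φ f • ψ = inner ℂ φ' f • ψ' ∧
      ∃ a c : ℂ, HasTraces f a c ∧ a = B * c ∧ a = B' * c := by
  obtain ⟨R, hR⟩ := hw
  have h := hR.mem_restrictedResolvents (defectSpace_subset_detectable hz hu)
  rw [hF] at h
  obtain ⟨-, -, R', hR', he : R' u = R u⟩ := h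
  obtain ⟨a, c, ht, hac, hr⟩ := ((isResolventAt_bdryOp_iff φ ψ B w R).1 hR).1 u
  obtain ⟨a', c', ht', hac', hr'⟩ := ((isResolventAt_bdryOp_iff φ' ψ' B' w R').1 hR').1 u
  rw [he] at ht' hr'
  obtain ⟨rfl, rfl⟩ := ht.unique ht'
  refine ⟨R u, ?_, ?_, a, c, ht, hac, hac'⟩
  · obtain ⟨d, hd⟩ := (mem_defectSpace_iff φ ψ z u).1 hu
    refine (mem_defectSpace_iff φ ψ w _).2 ⟨d + (w - z) * c, ?_⟩
    convert hd.add (hr.smul (w - z)) using 1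
    module
  -- The two graph relations of `R u` share the image, the function and `Γ₂`, so they can differ
  -- only in the rank-one terms.
  · refine Lp.ext ?_
    filter_upwards [hr, hr', Lp.coeFn_smul (inner ℂ φ (R u)) ψ,
      Lp.coeFn_smul (inner ℂ φ' (R u)) ψ'] with x h1 h2 h3 h4
    rw [h3, h4, Pi.smul_apply, Pi.smul_apply, smul_eq_mul, smul_eq_mul]
    linear_combination h2 - h1

theorem exists_sign_ne (B : ℂ) : ∃ σ : ℝ, σ ^ 2 = 1 ∧ B ≠ σ * Real.pi * Complex.I := by
  by_contra! h
  have h1 := h 1 (by norm_num)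
  have h2 := h (-1) (by norm_num)
  have := congrArg Complex.im (h1.symm.trans h2)
  simp at this
  linarith [Real.pi_pos]

theorem boundaryParameter_eq {φ ψ φ' ψ' : L2} {B B' z : ℂ}
    (hF : restrictedResolvents φ ψ B = restrictedResolvents φ' ψ' B')
    (hz : z ∈ resolventSet (bdryOp φ ψ B)) : B = B' := by
  by_contra hBB
  obtain ⟨u, hu, a, c, ht, hac⟩ := exists_normalized_defect hz
  have key : ∀ σ : ℝ, σ ^ 2 = 1 → a - c * (σ * Real.pi * Complex.I) = 0 := by
    intro σ hσ
    have hev : ∀ᶠ t in atTop, imagPt σ t ∈ resolventSet (bdryOp φ ψ B) := by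
      -- If `B` is the exceptional value for this half-axis, `B'` is not, and the resolvent sets
      -- coincide.
      by_cases hB : B = σ * Real.pi * Complex.I
      · filter_upwards [eventually_mem_resolventSet φ' ψ' hσ (B := B')
          (fun h => hBB (hB.trans h.symm))] with t h
        exact mem_resolventSet_of_restrictedResolvents_eq hF.symm h
      · exact eventually_mem_resolventSet φ ψ hσ hB
    have hlim : Tendsto (fun t : ℝ => 2 * (‖φ‖ * ‖ψ‖) * (Real.pi / t) * ‖c‖) atTop (𝓝 0) := by
      have := ((tendsto_const_nhds (x := Real.pi)).div_atTop tendsto_id).const_mul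
        (2 * (‖φ‖ * ‖ψ‖)) |>.mul_const ‖c‖
      simpa using this
    rw [← norm_le_zero_iff]
    refine ge_of_tendsto hlim ?_
    filter_upwards [hev, eventually_defect_estimate φ ψ hσ] with t h1 h2
    obtain ⟨f, hf, -, a₁, c₁, ht₁, e, e'⟩ := exists_defect_continuation hF hz h1 hu
    have hc₁ : c₁ = 0 := by
      have : (B - B') * c₁ = 0 := by linear_combination e' - e
      exact (mul_eq_zero.1 this).resolve_left (sub_ne_zero.2 hBB)
    have ha₁ : a₁ = 0 := by rw [e, hc₁, mul_zero]
    rw [hc₁, ha₁] at ht₁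
    have := ht.add (ht₁.smul (imagPt σ t - z))
    simp only [mul_zero, add_zero] at this
    exact (h2 _ hf a c this).2
  have h1 := key 1 (by norm_num)
  have h2 := key (-1) (by norm_num)
  have hc : c * (Real.pi * Complex.I) = 0 := by
    push_cast at h1 h2
    linear_combination (h2 - h1) / 2
  have hc0 : c = 0 := by
    refine (mul_eq_zero.1 hc).resolve_right (mul_ne_zero ?_ Complex.I_ne_zero)
    exact_mod_cast Real.pi_ne_zero
  rw [hc0, zero_mul, sub_zero] at h1
  rw [h1, hc0] at hac
  simp at hac

/-- Since `a ≈ σ π i c`, the normalisation reads `c (σ π i - B) ≈ 1`; so `c` stays bounded and the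
norm is `O(t^(-1/2))`. -/
theorem normalized_defect_tendsto_zero (φ ψ : L2) {σ : ℝ} (hσ : σ ^ 2 = 1) {B : ℂ}
    (hB : B ≠ σ * Real.pi * Complex.I) {v : ℝ → L2}
    (hv : ∀ᶠ t in atTop, v t ∈ defectSpace φ ψ (imagPt σ t) ∧
      ∃ a c : ℂ, HasTraces (v t) a c ∧ a - B * c = 1) :
    Tendsto v atTop (𝓝 0) := by
  set b := ‖(σ : ℂ) * Real.pi * Complex.I - B‖ with hb
  have hb0 : 0 < b := norm_pos_iff.2 (sub_ne_zero.2 hB.symm)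
  have hinv : Tendsto (fun t : ℝ => Real.pi / t) atTop (𝓝 0) :=
    tendsto_const_nhds.div_atTop tendsto_id
  have hsmall : ∀ᶠ t : ℝ in atTop, 2 * (‖φ‖ * ‖ψ‖) * (Real.pi / t) < b / 2 := by
    have := hinv.const_mul (2 * (‖φ‖ * ‖ψ‖))
    rw [mul_zero] at this
    exact this.eventually (gt_mem_nhds (half_pos hb0))
  have hlim : Tendsto (fun t : ℝ => 2 * (2 / b) * √(Real.pi / t)) atTop (𝓝 0) := by
    have := (hinv.sqrt).const_mul (2 * (2 / b))
    simpa using this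
  refine squeeze_zero_norm' ?_ hlim
  filter_upwards [hv, hsmall, eventually_defect_estimate φ ψ hσ] with t ⟨h1, a, c, h2, h3⟩ h4 h5
  obtain ⟨h6, h7⟩ := h5 _ h1 a c h2
  refine h6.trans ?_
  gcongr
  have h8 : c * (σ * Real.pi * Complex.I - B) = 1 - (a - c * (σ * Real.pi * Complex.I)) := by
    linear_combination h3
  have h9 : ‖c‖ * b ≤ 1 + b / 2 * ‖c‖ := by
    rw [hb, ← norm_mul, h8]
    refine (norm_sub_le _ _).trans ?_
    rw [norm_one]
    gcongr
    exact h7.trans (by gcongr)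
  rw [le_div_iff₀ hb0]
  linarith

theorem perturbation_eq_on_defectSpace {φ ψ φ' ψ' : L2} {B B' z : ℂ}
    (hF : restrictedResolvents φ ψ B = restrictedResolvents φ' ψ' B')
    (hz : z ∈ resolventSet (bdryOp φ ψ B)) {u : L2} (hu : u ∈ defectSpace φ ψ z)
    {a c : ℂ} (ht : HasTraces u a c) (hac : a - B * c = 1) :
    inner ℂ φ u • ψ = inner ℂ φ' u • ψ' := by
  obtain ⟨σ, hσ, hB⟩ := exists_sign_ne B
  have hf : ∀ t, ∃ f : L2, imagPt σ t ∈ resolventSet (bdryOp φ ψ B) →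
      u + (imagPt σ t - z) • f ∈ defectSpace φ ψ (imagPt σ t) ∧
      inner ℂ φ f • ψ = inner ℂ φ' f • ψ' ∧
      ∃ a c : ℂ, HasTraces f a c ∧ a = B * c ∧ a = B' * c := by
    intro t
    by_cases h : imagPt σ t ∈ resolventSet (bdryOp φ ψ B)
    · obtain ⟨f, hf⟩ := exists_defect_continuation hF hz h hu
      exact ⟨f, fun _ => hf⟩
    -- An arbitrary value off the resolvent set; only large `t` matter.
    · exact ⟨0, fun h' => (h h').elim⟩
  choose f hf using hf
  have hev := eventually_mem_resolventSet φ ψ hσ hB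
  have hlim : Tendsto (fun t => u + (imagPt σ t - z) • f t) atTop (𝓝 0) := by
    refine normalized_defect_tendsto_zero φ ψ hσ hB ?_
    filter_upwards [hev] with t h
    obtain ⟨h1, -, a₁, c₁, h2, h3, -⟩ := hf t h
    refine ⟨h1, _, _, ht.add (h2.smul _), ?_⟩
    rw [h3]
    linear_combination hac
  -- `K` is the difference of the perturbations. It kills every `f t`, so `K u` equals `K` of the
  -- continued element, which tends to `0`.
  set K : L2 →L[ℂ] L2 := (innerSL ℂ φ).smulRight ψ - (innerSL ℂ φ').smulRight ψ' with hK
  have hKa : ∀ x, K x = inner ℂ φ x • ψ - inner ℂ φ' x • ψ' := fun x => by simp [hK]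
  have hKlim := (K.continuous.tendsto 0).comp hlim
  rw [map_zero] at hKlim
  have hKu : K u = 0 := by
    refine tendsto_nhds_unique (tendsto_const_nhds.congr' ?_) hKlim
    filter_upwards [hev] with t h
    have h0 : K (f t) = 0 := by rw [hKa, (hf t h).2.1, sub_self]
    rw [Function.comp_apply, map_add, map_smul, h0, smul_zero, add_zero]
  rwa [hKa, sub_eq_zero] at hKu

/-- Two Friedrichs models with the same family of restricted resolvents have the same
`M`-function. -/
theorem IsMValue.eq_of_restrictedResolvents_eq {φ ψ φ' ψ' : L2} {B B' z m m' : ℂ}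
    (hF : restrictedResolvents φ ψ B = restrictedResolvents φ' ψ' B')
    (hz : z ∈ resolventSet (bdryOp φ ψ B)) (hm : IsMValue φ ψ B z m)
    (hm' : IsMValue φ' ψ' B' z m') : m = m' := by
  obtain ⟨u, hu, a, c, ht, hac⟩ := exists_normalized_defect hz
  have hB := boundaryParameter_eq hF hz
  have hK := perturbation_eq_on_defectSpace hF hz hu ht hac
  have hu' : u ∈ defectSpace φ' ψ' z := by
    obtain ⟨d, hd⟩ := (mem_defectSpace_iff φ ψ z u).1 hu
    refine (mem_defectSpace_iff φ' ψ' z u).2 ⟨d, ?_⟩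
    rw [maxRel_iff_sub] at hd ⊢
    rwa [← hK]
  rw [hm.eq_of_hasTraces hu ht hac, hm'.eq_of_hasTraces hu' ht (hB ▸ hac)]

end Friedrichs

end

/-! ### The recovering map -/

theorem theorem7p1 :
    ∃ recover : Set (ℂ × Friedrichs.L2 × Friedrichs.L2) → ℂ → ℂ,
      ∀ (φ ψ : Friedrichs.L2) (B : ℂ),
        ∀ z ∈ Friedrichs.resolventSet (Friedrichs.bdryOp φ ψ B),
          Friedrichs.IsMValue φ ψ B z
            (recover (Friedrichs.restrictedResolvents φ ψ B) z) := by
  classical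
  have h : ∀ (F : Set (ℂ × Friedrichs.L2 × Friedrichs.L2)) (z : ℂ), ∃ m : ℂ,
      ∀ (φ ψ : Friedrichs.L2) (B : ℂ), F = Friedrichs.restrictedResolvents φ ψ B →
        z ∈ Friedrichs.resolventSet (Friedrichs.bdryOp φ ψ B) →
          Friedrichs.IsMValue φ ψ B z m := by
    intro F z
    by_cases hex : ∃ (φ ψ : Friedrichs.L2) (B : ℂ), F = Friedrichs.restrictedResolvents φ ψ B ∧
        z ∈ Friedrichs.resolventSet (Friedrichs.bdryOp φ ψ B)
    · obtain ⟨φ, ψ, B, hF, hz⟩ := hex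
      obtain ⟨m, hm⟩ := Friedrichs.exists_isMValue hz
      refine ⟨m, fun φ' ψ' B' hF' hz' => ?_⟩
      obtain ⟨m', hm'⟩ := Friedrichs.exists_isMValue hz'
      rwa [hm.eq_of_restrictedResolvents_eq (hF.symm.trans hF') hz hm']
    -- No model with family `F` has `z` in its resolvent set, so the value is arbitrary.
    · exact ⟨0, fun φ ψ B hF hz => (hex ⟨φ, ψ, B, hF, hz⟩).elim⟩
  choose recover hrec using h
  exact ⟨recover, fun φ ψ B z hz => hrec _ z φ ψ B rfl hz⟩
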